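/- Let $\Sigma$ be an alphabet. An LZ-End factorization of a string $T\in\Sigma^*$ is a sequence $f_1,\dots,f_z$ of non-empty strings with $T=f_1\cdots f_z$ such that each $f_k$ is either a single character not occurring in $f_1\cdots f_{k-1}$, or a suffix of $f_1\cdots f_h$ for some $1\le h<k$. Let $z_{\mathrm{End}}^{\mathrm{opt}}(T)$ be the smallest number of phrases of an LZ-End factorization of $T$. For an edit type $e\in\{\mathrm{sub},\mathrm{ins},\mathrm{del}\}$ (substitution of one character by a different one, insertion of one character, deletion of one character) and $n\ge 1$ let $$\mathrm{MS}_e(n)=\max\left\{\frac{z_{\mathrm{End}}^{\mathrm{opt}}(T')}{z_{\mathrm{End}}^{\mathrm{opt}}(T)} : T\in\Sigma^n,\ T' \text{ is obtained from } T \text{ by one edit operation of type } e\right\},$$ and put $s_{\mathrm{sub}}=3$, $s_{\mathrm{del}}=3$, $s_{\mathrm{ins}}=2$. Then the multiplicative sensitivity of optimal LZ-End is $3$ for substitutions, $3$ for deletions and $2$ for insertions, in the following sense. For every alphabet $\Sigma$, every edit type $e$, every non-empty string $T$ over $\Sigma$, and every $T'$ obtained from $T$ by one edit operation of type $e$, $$z_{\mathrm{End}}^{\mathrm{opt}}(T')\le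 s_e\cdot z_{\mathrm{End}}^{\mathrm{opt}}(T).$$ Moreover, if $\Sigma$ is infinite (so that strings may use arbitrarily many distinct characters), then for every $e$ the maximum $\mathrm{MS}_e(n)$ exists and is at most $s_e$ for all $n\ge 1$, and $$\lim_{n\to\infty}\mathrm{MS}_e(n)=s_e .$$ -/

import Mathlib

namespace LZEnd

variable {α : Type*}

/-- `fs = [f₀, …, f_{z-1}]` is an LZ-End factorization of `T`: the phrases are non-empty, their
concatenation is `T`, and each phrase `f_k` is either a fresh character (one that does not occur in
`f₀ ⋯ f_{k-1}`), or a copy of a substring of `f₀ ⋯ f_{k-1}` that ends where one of the previous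
phrases ends, that is, a suffix of the concatenation of the first `h` phrases for some
`1 ≤ h ≤ k`. -/
def IsFactorization (T : List α) (fs : List (List α)) : Prop :=
  fs.flatten = T ∧
    ∀ (k : ℕ) (hk : k < fs.length), fs[k] ≠ [] ∧
      ((∃ c : α, fs[k] = [c] ∧ c ∉ (fs.take k).flatten) ∨
        ∃ h : ℕ, 1 ≤ h ∧ h ≤ k ∧ fs[k] <:+ (fs.take h).flatten)

/-- The size of the optimal LZ-End factorization: the least number of phrases of an LZ-End
factorization of `T`. -/
noncomputable def zEndOpt (T : List α) : ℕ :=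
  sInf {z : ℕ | ∃ fs : List (List α), IsFactorization T fs ∧ fs.length = z}

/-- Every string has an LZ-End factorization (into single characters). -/
theorem exists_isFactorization (T : List α) : ∃ fs, IsFactorization T fs := by
  have flat : ∀ S : List α, (S.map (fun c => [c])).flatten = S := by
    intro S
    induction S with
    | nil => rfl
    | cons a S ih => simp [ih]
  refine ⟨T.map (fun c => [c]), flat T, ?_⟩
  intro k hk
  have hk' : k < T.length := by simpa using hk
  refine ⟨by simp, ?_⟩
  by_cases hc : T[k] ∈ T.take k
  · right
    obtain ⟨i, hi, hik⟩ := List.getElem_of_mem hc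
    have hi' : i < k := by
      have := hi
      simp only [List.length_take] at this
      omega
    refine ⟨i + 1, by omega, by omega, ?_⟩
    rw [← List.map_take, flat, List.getElem_map, ← hik, List.getElem_take]
    rw [List.take_succ_eq_append_getElem (by omega)]
    exact List.suffix_append _ _
  · left
    refine ⟨T[k], by simp, ?_⟩
    rw [← List.map_take, flat]
    exact hc

/-- The minimum in the definition of `zEndOpt` is attained. -/
theorem exists_optimal (T : List α) : ∃ fs, IsFactorization T fs ∧ fs.length = zEndOpt T := by
  obtain ⟨fs, hfs⟩ := exists_isFactorization T
  exact Nat.sInf_mem (s := {z : ℕ | ∃ fs : List (List α), IsFactorization T fs ∧ fs.length = z})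
    ⟨fs.length, fs, hfs, rfl⟩

/-- The three types of single-character edit operations. -/
inductive Edit
  | sub
  | ins
  | del

/-- `IsEdit e T T'`: the string `T'` is obtained from `T` by one edit operation of type `e`
(substitution of one character by a different one, insertion of one character, deletion of one
character). -/
def IsEdit : Edit → List α → List α → Prop
  | .sub, T, T' => ∃ (u v : List α) (a b : α), a ≠ b ∧ T = u ++ a :: v ∧ T' = u ++ b :: v
  | .ins, T, T' => ∃ (u v : List α) (b : α), T = u ++ v ∧ T' = u ++ b :: v
  | .del, T, T' => ∃ (u v : List α) (a : α), T = u ++ a :: v ∧ T' = u ++ v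

/-- The set of all ratios `c(T') / c(T)`, where `T` has length `n` and `T'` is obtained from `T`
by one edit operation of type `e`. -/
def ratios (e : Edit) (c : List α → ℕ) (n : ℕ) : Set ℝ :=
  {r | ∃ T T' : List α, T.length = n ∧ IsEdit e T T' ∧ r = (c T' : ℝ) / (c T : ℝ)}

/-- The worst-case multiplicative sensitivity of the measure `c` at length `n`: the largest
element of `ratios e c n`. -/
noncomputable def MS (e : Edit) (c : List α → ℕ) (n : ℕ) : ℝ :=
  sSup (ratios e c n)

/-- The claimed multiplicative sensitivity of optimal LZ-End for each type of edit operation. -/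
def msValue : Edit → ℕ
  | .sub => 3
  | .ins => 2
  | .del => 3

end LZEnd

/-! Upper bound. Write `T = u s v` and `T' = u r v`, where `s` and `r` have length at most one, and
transport an optimal factorization of `T` phrase by phrase, keeping every old boundary as a boundary
of `T'`. A phrase whose source ends before the edit, or which avoids the edit inside its source,
stays a single phrase. A phrase whose copied text spans the edit becomes a suffix of `u`, then the
letters of `s`, then a suffix of a later prefix of `T'`: at most `2 + |s|` phrases, that is 3 for
substitution and deletion and 2 for insertion. The one phrase in which the edit happens may need as
many extra phrases as precede it (`Fac.append_infix`), which the factor `2 + |s|` also absorbs. This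
is `Fac.edit`.

Lower bound. The string is a long ramp, the separator `e 3 e 4`, and the blocks of the Zimin word
`zimin k`. Passing from `zimin j` to `zimin (j + 1)` appends a ramp of length `j + 1`, the separator
and a copy of all previous blocks, which is a suffix of the whole string so far and thus one phrase;
the ramp costs only logarithmically many phrases. The edit detaches the first ramp from its
separator `e 3`. Then each Zimin level contains three words (two after an insertion) that occur
there for the first time, successive ones sharing one letter. A phrase boundary lies strictly inside
each first occurrence (`Fac.exists_boundary`), so the edited string needs about `3k`, respectively
`2k`, phrases against `k + O(log k)`. Padding by two more phrases reaches every large length. -/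

namespace LZEnd

variable {α : Type*}

/-! ### Factorizations built phrase by phrase -/

/-- `Fac n T B`: the string `T` has an LZ-End factorization into `n` phrases whose concatenations of
leading phrases form the set `B`. -/
inductive Fac : ℕ → List α → Set (List α) → Prop
  | nil : Fac 0 [] {[]}
  | fresh {n : ℕ} {T : List α} {B : Set (List α)} (c : α) (h : Fac n T B) (hc : c ∉ T) :
      Fac (n + 1) (T ++ [c]) (insert (T ++ [c]) B)
  | copy {n : ℕ} {T : List α} {B : Set (List α)} (f P : List α) (h : Fac n T B) (hf : f ≠ [])
      (hP : P ∈ B) (hs : f <:+ P) : Fac (n + 1) (T ++ f) (insert (T ++ f) B)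

namespace Fac

theorem self_mem {n : ℕ} {T : List α} {B : Set (List α)} (h : Fac n T B) : T ∈ B := by
  cases h <;> simp

theorem isPrefix {n : ℕ} {T : List α} {B : Set (List α)} (h : Fac n T B) {P : List α}
    (hP : P ∈ B) : P <+: T := by
  induction h with
  | nil => simp_all
  | fresh c h hc ih =>
    rcases hP with rfl | hP
    · exact List.prefix_rfl
    · exact (ih hP).trans (List.prefix_append _ _)
  | copy f Q h hf hQ hs ih =>
    rcases hP with rfl | hP
    · exact List.prefix_rfl
    · exact (ih hP).trans (List.prefix_append _ _)

theorem exists_isFactorization {n : ℕ} {T : List α} {B : Set (List α)} (h : Fac n T B) :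
    ∃ fs, IsFactorization T fs ∧ fs.length = n ∧
      ∀ P ∈ B, ∃ i ≤ n, (fs.take i).flatten = P := by
  have snoc : ∀ {n : ℕ} {T f : List α} {B : Set (List α)} (fs : List (List α)),
      IsFactorization T fs → fs.length = n → (∀ P ∈ B, ∃ i ≤ n, (fs.take i).flatten = P) →
      (f ≠ [] ∧ ((∃ c : α, f = [c] ∧ c ∉ T) ∨
        ∃ h : ℕ, 1 ≤ h ∧ h ≤ n ∧ f <:+ (fs.take h).flatten)) →
      ∃ gs, IsFactorization (T ++ f) gs ∧ gs.length = n + 1 ∧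
        ∀ P ∈ insert (T ++ f) B, ∃ i ≤ n + 1, (gs.take i).flatten = P := by
    intro n T f B fs hfs hn hB hf
    have htake : ∀ i ≤ n, (fs ++ [f]).take i = fs.take i := fun i hi =>
      List.take_append_of_le_length (by omega)
    refine ⟨fs ++ [f], ⟨by simp [hfs.1], ?_⟩, by simp [hn], ?_⟩
    · intro k hk
      have hk' : k ≤ n := by simp at hk; omega
      rw [htake k hk']
      rcases Nat.lt_or_ge k fs.length with hlt | hge
      · rw [List.getElem_append_left hlt]
        refine ⟨(hfs.2 k hlt).1, (hfs.2 k hlt).2.imp id ?_⟩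
        rintro ⟨i, h1, h2, h3⟩
        exact ⟨i, h1, h2, by rwa [htake i (by omega)]⟩
      · have hkn : k = fs.length := by omega
        subst hkn
        simp only [List.getElem_concat_length, List.take_length, hfs.1]
        refine ⟨hf.1, hf.2.imp id ?_⟩
        rintro ⟨i, h1, h2, h3⟩
        exact ⟨i, h1, by omega, by rwa [htake i h2]⟩
    · rintro P (rfl | hP)
      · exact ⟨n + 1, le_rfl, by rw [List.take_of_length_le (by simp [hn])]; simp [hfs.1]⟩
      · obtain ⟨i, hi, rfl⟩ := hB P hP
        exact ⟨i, by omega, by rw [htake i hi]⟩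
  induction h with
  | nil => exact ⟨[], ⟨rfl, by simp⟩, rfl, by simp⟩
  | fresh c h hc ih =>
    obtain ⟨fs, h1, h2, h3⟩ := ih
    exact snoc fs h1 h2 h3 ⟨by simp, Or.inl ⟨c, rfl, hc⟩⟩
  | copy f P h hf hP hs ih =>
    obtain ⟨fs, h1, h2, h3⟩ := ih
    refine snoc fs h1 h2 h3 ⟨hf, Or.inr ?_⟩
    obtain ⟨i, hi, rfl⟩ := h3 P hP
    refine ⟨i, ?_, hi, hs⟩
    rcases Nat.eq_zero_or_pos i with rfl | h
    · simp_all
    · exact h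

theorem zEndOpt_le {n : ℕ} {T : List α} {B : Set (List α)} (h : Fac n T B) : zEndOpt T ≤ n := by
  obtain ⟨fs, h1, h2, -⟩ := h.exists_isFactorization
  exact Nat.sInf_le ⟨fs, h1, h2⟩

end Fac

theorem IsFactorization.exists_fac {T : List α} {fs : List (List α)} (h : IsFactorization T fs) :
    ∃ B, Fac fs.length T B := by
  have key : ∀ k ≤ fs.length, ∃ B, Fac k (fs.take k).flatten B ∧
      ∀ i ≤ k, (fs.take i).flatten ∈ B := by
    intro k
    induction k with
    | zero => intro _; exact ⟨{[]}, by simpa using Fac.nil, by simp⟩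
    | succ k ih =>
      intro hk
      obtain ⟨B, hB, hmem⟩ := ih (by omega)
      have heq : (fs.take (k + 1)).flatten = (fs.take k).flatten ++ fs[k] := by
        rw [List.take_succ_eq_append_getElem (by omega), List.flatten_append,
          List.flatten_singleton]
      refine ⟨insert ((fs.take k).flatten ++ fs[k]) B, ?_, ?_⟩
      · rw [heq]
        obtain ⟨hne, ⟨c, hc, hc'⟩ | ⟨i, h1, h2, h3⟩⟩ := h.2 k (by omega)
        · rw [hc]; exact .fresh c hB hc'
        · exact .copy _ _ hB hne (hmem i h2) h3
      · intro i hi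
        rcases Nat.lt_or_ge i (k + 1) with hlt | hge
        · exact Or.inr (hmem i (by omega))
        · obtain rfl : i = k + 1 := by omega
          exact Or.inl heq
  obtain ⟨B, hB, -⟩ := key fs.length le_rfl
  exact ⟨B, by simpa [h.1] using hB⟩

theorem exists_fac_zEndOpt (T : List α) : ∃ B, Fac (zEndOpt T) T B := by
  obtain ⟨fs, h1, h2⟩ := exists_optimal T
  exact h2 ▸ h1.exists_fac

theorem zEndOpt_le_length (T : List α) : zEndOpt T ≤ T.length := by
  obtain ⟨fs, h1, h2⟩ := exists_optimal T
  rw [← h2, ← h1.1, List.length_flatten]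
  refine (List.length_map (f := List.length) (as := fs)) ▸ List.length_le_sum_of_one_le _ ?_
  intro i hi
  obtain ⟨f, hf, rfl⟩ := List.mem_map.1 hi
  obtain ⟨k, hk, rfl⟩ := List.getElem_of_mem hf
  exact List.length_pos_iff.2 (h1.2 k hk).1

theorem zEndOpt_pos {T : List α} (hT : T ≠ []) : 0 < zEndOpt T := by
  obtain ⟨B, hB⟩ := exists_fac_zEndOpt T
  rcases Nat.eq_zero_or_pos (zEndOpt T) with h | h
  · rw [h] at hB
    cases hB
    exact absurd rfl hT
  · exact h

/-! ### Upper bound: repairing a factorization after an edit -/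

theorem eq_append_of_length_le_one {s v c t : List α} (hs : s.length ≤ 1) (hc : c ≠ [])
    (h : s ++ v = c ++ t) : ∃ w, c = s ++ w ∧ v = w ++ t := by
  match s, hs with
  | [], _ => exact ⟨c, rfl, h⟩
  | [a], _ =>
    obtain ⟨b, c, rfl⟩ := List.exists_cons_of_ne_nil hc
    obtain ⟨rfl, h⟩ := List.cons.inj h
    exact ⟨c, rfl, by simpa using h⟩

theorem append_eq_append_cases {s v A f u : List α} (hs : s.length ≤ 1)
    (h : A ++ f = u ++ (s ++ v)) :
    (∃ x, u = A ++ x ∧ f = x ++ (s ++ v)) ∨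
      ∃ w, s ++ w ≠ [] ∧ A = u ++ (s ++ w) ∧ v = w ++ f := by
  rcases List.append_eq_append_iff.1 h with ⟨x, h1, h2⟩ | ⟨c, h1, h2⟩
  · exact Or.inl ⟨x, h1, h2⟩
  · rcases eq_or_ne c [] with rfl | hc
    · exact Or.inl ⟨[], by simpa using h1.symm, by simpa using h2.symm⟩
    · obtain ⟨w, rfl, h3⟩ := eq_append_of_length_le_one hs hc h2
      exact Or.inr ⟨w, hc, h1, h3⟩

namespace Fac

theorem exists_suffix_of_mem {n : ℕ} {T : List α} {B : Set (List α)} (h : Fac n T B) {c : α}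
    (hc : c ∈ T) : ∃ P ∈ B, [c] <:+ P := by
  induction h with
  | nil => simp at hc
  | @fresh n T B d h hd ih =>
    by_cases hcT : c ∈ T
    · obtain ⟨P, hP, hs⟩ := ih hcT
      exact ⟨P, Or.inr hP, hs⟩
    · obtain rfl : c = d := by simpa [hcT] using hc
      exact ⟨_, Or.inl rfl, List.suffix_append _ _⟩
  | @copy n T B f P h hf hP hs ih =>
    have hcT : c ∈ T := by
      rcases List.mem_append.1 hc with h' | h'
      · exact h'
      · exact (h.isPrefix hP).subset (hs.subset h')
    obtain ⟨P, hP, hs⟩ := ih hcT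
    exact ⟨P, Or.inr hP, hs⟩

/-- A single letter always costs one phrase: if it is not fresh, some earlier boundary ends with it.
-/
theorem append_singleton {n : ℕ} {T : List α} {B : Set (List α)} (h : Fac n T B) (c : α) :
    Fac (n + 1) (T ++ [c]) (insert (T ++ [c]) B) := by
  by_cases hc : c ∈ T
  · obtain ⟨P, hP, hs⟩ := h.exists_suffix_of_mem hc
    exact h.copy _ _ (by simp) hP hs
  · exact h.fresh c hc

theorem append_of_length_le_one {n : ℕ} {T : List α} {B : Set (List α)} (h : Fac n T B)
    {s : List α} (hs : s.length ≤ 1) :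
    Fac (n + s.length) (T ++ s) (insert (T ++ s) B) := by
  match s, hs with
  | [], _ => simpa [Set.insert_eq_of_mem h.self_mem] using h
  | [c], _ => exact h.append_singleton c

theorem append_suffix {n : ℕ} {T : List α} {B : Set (List α)} (h : Fac n T B) {f P : List α}
    (hP : P ∈ B) (hs : f <:+ P) : ∃ m ≤ n + 1, Fac m (T ++ f) (insert (T ++ f) B) := by
  rcases eq_or_ne f [] with rfl | hf
  · exact ⟨n, by omega, by simpa [Set.insert_eq_of_mem h.self_mem] using h⟩
  · exact ⟨n + 1, le_rfl, h.copy f P hf hP hs⟩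

/-- A substring of a string with `n` phrases can be appended at the cost of `n` phrases, each of
which ends at one of the boundaries of that string. -/
theorem append_infix {n : ℕ} {T : List α} {B : Set (List α)} (h : Fac n T B) {x : List α}
    (hx : x <:+: T) {m : ℕ} {S : List α} {C : Set (List α)} (hS : Fac m S C) (hBC : B ⊆ C) :
    ∃ m' ≤ m + n, ∃ C', C ⊆ C' ∧ Fac m' (S ++ x) C' := by
  induction h generalizing x m S C with
  | nil =>
    obtain rfl : x = [] := by simpa using hx
    exact ⟨m, by omega, C, subset_rfl, by simpa using hS⟩
  | @fresh n T B c h hc ih =>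
    rcases List.infix_concat_iff.1 hx with hx' | hx'
    · obtain ⟨m', h1, h2⟩ := hS.append_suffix (hBC (Or.inl rfl)) hx'
      exact ⟨m', by omega, _, Set.subset_insert _ _, h2⟩
    · obtain ⟨m', h1, h2⟩ := ih hx' hS ((Set.subset_insert _ _).trans hBC)
      exact ⟨m', by omega, h2⟩
  | @copy n T B f P h hf hP hs ih =>
    have hBC' : B ⊆ C := (Set.subset_insert _ _).trans hBC
    have hfT : f <:+: T := hs.isInfix.trans (h.isPrefix hP).isInfix
    rcases List.infix_append_iff.1 hx with hx' | hx' | ⟨x1, x2, rfl, hx1, hx2⟩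
    · obtain ⟨m', h1, h2⟩ := ih hx' hS hBC'
      exact ⟨m', by omega, h2⟩
    · obtain ⟨m', h1, h2⟩ := ih (hx'.trans hfT) hS hBC'
      exact ⟨m', by omega, h2⟩
    -- A substring crossing the last boundary is a suffix of `T`, one phrase, followed by a prefix
    -- of `f`; the latter already occurs in `T`, so the induction hypothesis pays for it.
    · obtain ⟨m1, h1, h2⟩ := hS.append_suffix (hBC' h.self_mem) hx1
      obtain ⟨m', h3, C', h4, h5⟩ := ih (hx2.isInfix.trans hfT) h2
        (hBC'.trans (Set.subset_insert _ _))
      exact ⟨m', by omega, C', (Set.subset_insert _ _).trans h4, by simpa using h5⟩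

/-- Replacing a string `s` of length at most one by another string `r` of length at most one. The
boundaries of the old factorization survive, and there is a new one in front of the edit. -/
theorem edit {n : ℕ} {T : List α} {B : Set (List α)} (h : Fac n T B) {s r : List α}
    (hs : s.length ≤ 1) (hr : r.length ≤ 1) {u v : List α} (hT : T = u ++ (s ++ v))
    (hsv : s ++ v ≠ []) :
    ∃ m ≤ (2 + s.length) * n, ∃ B', Fac m (u ++ (r ++ v)) B' ∧ u ∈ B' ∧
      (∀ P ∈ B, P <+: u → P ∈ B') ∧
      ∀ w, s ++ w ≠ [] → u ++ (s ++ w) ∈ B → u ++ (r ++ w) ∈ B' := by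
  -- Bookkeeping common to all cases: the boundary closing the new phrase lies after the edit and
  -- corresponds to the end of the edited string.
  have lift : ∀ {n k : ℕ} {T₀ f : List α} {B : Set (List α)}, Fac n T₀ B → 1 ≤ k →
      ∀ {v₀ : List α} {m : ℕ} {B₁ B₂ : Set (List α)},
      T₀ ++ f = u ++ (s ++ v₀) → s ++ v₀ ≠ [] →
      (u ∈ B₁ ∧ (∀ P ∈ B, P <+: u → P ∈ B₁) ∧
        ∀ w, s ++ w ≠ [] → u ++ (s ++ w) ∈ B → u ++ (r ++ w) ∈ B₁) →
      B₁ ⊆ B₂ → Fac m (u ++ (r ++ v₀)) B₂ → m ≤ k →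
      ∃ m ≤ k, ∃ B', Fac m (u ++ (r ++ v₀)) B' ∧ u ∈ B' ∧
        (∀ P ∈ insert (T₀ ++ f) B, P <+: u → P ∈ B') ∧
        ∀ w, s ++ w ≠ [] → u ++ (s ++ w) ∈ insert (T₀ ++ f) B → u ++ (r ++ w) ∈ B' := by
    intro n k T₀ f B h hk v₀ m B₁ B₂ hT hsv ⟨h1, h2, h3⟩ h4 h5 h6
    refine ⟨m, h6, B₂, h5, h4 h1, ?_, ?_⟩
    · rintro P (rfl | hP) hPu
      · have := hPu.length_le
        rw [hT] at this
        have := List.length_pos_iff.2 hsv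
        simp only [List.length_append] at *
        omega
      · exact h4 (h2 P hP hPu)
    · rintro w hw (hP | hP)
      · rw [hT] at hP
        obtain rfl := List.append_cancel_left (List.append_cancel_left hP)
        exact h5.self_mem
      · exact h4 (h3 w hw hP)
  -- The phrase containing the edit: `x` costs at most `n` phrases as a substring of `T₀`, `r` at
  -- most one, and the rest one more. The total `2n + 2` fits into `(2 + |s|)(n + 1)`.
  have inside : ∀ {n : ℕ} {T₀ f x v : List α} {B : Set (List α)}, Fac n T₀ B → u = T₀ ++ x →
      f = x ++ (s ++ v) → s ++ v ≠ [] → x <:+: T₀ → (v.length ≤ 1 ∨ ∃ P ∈ B, v <:+ P) →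
      ∃ m ≤ (2 + s.length) * (n + 1), ∃ B', Fac m (u ++ (r ++ v)) B' ∧ u ∈ B' ∧
        (∀ P ∈ insert (T₀ ++ f) B, P <+: u → P ∈ B') ∧
        ∀ w, s ++ w ≠ [] → u ++ (s ++ w) ∈ insert (T₀ ++ f) B → u ++ (r ++ w) ∈ B' := by
    intro n T₀ f x v B h hu hf hsv hx hv
    obtain ⟨m₁, h1, B₁, hB₁, h2⟩ := h.append_infix hx h subset_rfl
    rw [← hu] at h2
    have h3 := h2.append_of_length_le_one hr
    obtain ⟨m₂, h4, B₂, hB₂, h5⟩ : ∃ m₂ ≤ m₁ + r.length + 1, ∃ B₂, B₁ ⊆ B₂ ∧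
        Fac m₂ (u ++ r ++ v) B₂ := by
      rcases hv with hv | ⟨P, hP, hs⟩
      · exact ⟨_, by gcongr, _, (Set.subset_insert _ _).trans (Set.subset_insert _ _),
          h3.append_of_length_le_one hv⟩
      · obtain ⟨m₂, h4, h5⟩ := h3.append_suffix (Or.inr (hB₁ hP)) hs
        exact ⟨m₂, h4, _, (Set.subset_insert _ _).trans (Set.subset_insert _ _), h5⟩
    refine lift h (Nat.mul_pos (by omega) (by omega)) (by rw [hf, hu]; simp) hsv (B₁ := B₁)
      ⟨h2.self_mem, fun P hP _ => hB₁ hP, ?_⟩ hB₂ (by simpa using h5) (by nlinarith)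
    intro w hw hP
    have hlen := (h.isPrefix hP).length_le
    have := List.length_pos_iff.2 hw
    have := congrArg List.length hu
    simp only [List.length_append] at *
    omega
  induction h generalizing v with
  | nil => simp_all
  | @fresh n T₀ B c h hc ih =>
    rcases append_eq_append_cases hs hT with ⟨x, hu, hf⟩ | ⟨w, hw, rfl, rfl⟩
    · refine inside h hu hf hsv ?_ ?_
      · rcases x with _ | ⟨y, x⟩
        · exact List.nil_infix
        · simp at hf hsv
          tauto
      · have := congrArg List.length hf
        simp only [List.length_append, List.length_singleton] at this
        exact Or.inl (by omega)
    · obtain ⟨m, h1, B', h2, h3⟩ := ih rfl hw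
      refine lift h (by nlinarith) hT hsv h3 (Set.subset_insert _ _)
        (by simpa using h2.append_singleton c) (by nlinarith)
  | @copy n T₀ B f P h hf hP hfP ih =>
    rcases append_eq_append_cases hs hT with ⟨x, hu, hf⟩ | ⟨w, hw, rfl, rfl⟩
    · refine inside h hu hf hsv ?_ (Or.inr ⟨P, hP, ?_⟩)
      · exact (hf ▸ (List.prefix_append x _).isInfix).trans
          (hfP.isInfix.trans (h.isPrefix hP).isInfix)
      · exact ((List.suffix_append s v).trans (hf ▸ List.suffix_append x _)).trans hfP
    · obtain ⟨m, h1, B', h2, hu, h3, h4⟩ := ih rfl hw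
      have h0 := fun m' B₂ => lift (m := m') (B₂ := B₂) h (k := (2 + s.length) * (n + 1))
        (by nlinarith) hT hsv ⟨hu, h3, h4⟩
      obtain ⟨t, ht⟩ := h.isPrefix hP
      rcases append_eq_append_cases hs ht with ⟨x, hux, -⟩ | ⟨w', hw', rfl, -⟩
      · obtain ⟨m', h5, h6⟩ := h2.append_suffix (h3 P hP ⟨x, hux.symm⟩) hfP
        exact h0 _ _ (Set.subset_insert _ _) (by simpa using h6) (by nlinarith)
      · have hwB := h4 w' hw' hP
        obtain ⟨t', ht'⟩ := hfP
        rcases append_eq_append_cases hs ht' with ⟨x, hux, rfl⟩ | ⟨w'', -, -, rfl⟩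
        -- The copied text spans the edit. This is the only case after the edit that splits a
        -- phrase, into `x`, `s` and `w'`.
        · obtain ⟨m', h5, h6⟩ := h2.append_suffix hu ⟨t', hux.symm⟩
          have h7 := h6.append_of_length_le_one hs
          obtain ⟨m'', h8, h9⟩ := h7.append_suffix (f := w') (Or.inr (Or.inr hwB))
            ((List.suffix_append r w').trans (List.suffix_append u _))
          refine h0 _ _ ?_ (by simpa using h9) (by nlinarith)
          exact (Set.subset_insert _ _).trans
            ((Set.subset_insert _ _).trans (Set.subset_insert _ _))
        · obtain ⟨m', h5, h6⟩ := h2.append_suffix hwB (f := f)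
            ((List.suffix_append w'' f).trans
              ((List.suffix_append r _).trans (List.suffix_append u _)))
          exact h0 _ _ (Set.subset_insert _ _) (by simpa using h6) (by nlinarith)

end Fac

theorem zEndOpt_edit_le {s r : List α} (hs : s.length ≤ 1) (hr : r.length ≤ 1) {u v : List α}
    (hsv : s ++ v ≠ []) :
    zEndOpt (u ++ (r ++ v)) ≤ (2 + s.length) * zEndOpt (u ++ (s ++ v)) := by
  obtain ⟨B, hB⟩ := exists_fac_zEndOpt (u ++ (s ++ v))
  obtain ⟨m, hm, B', hB', -⟩ := hB.edit hs hr rfl hsv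
  exact hB'.zEndOpt_le.trans hm

theorem zEndOpt_le_of_isEdit {e : Edit} {T T' : List α} (hT : T ≠ []) (h : IsEdit e T T') :
    zEndOpt T' ≤ msValue e * zEndOpt T := by
  cases e with
  | sub =>
    obtain ⟨u, v, a, b, -, rfl, rfl⟩ := h
    exact zEndOpt_edit_le (s := [a]) (r := [b]) (by simp) (by simp) (by simp)
  | del =>
    obtain ⟨u, v, a, rfl, rfl⟩ := h
    exact zEndOpt_edit_le (s := [a]) (r := []) (by simp) (by simp) (by simp)
  | ins =>
    obtain ⟨u, v, b, rfl, rfl⟩ := h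
    rcases eq_or_ne v [] with rfl | hv
    -- Insertion at the very end lies outside `Fac.edit`, but costs only one additional phrase.
    · obtain ⟨B, hB⟩ := exists_fac_zEndOpt u
      have h1 := (hB.append_singleton b).zEndOpt_le
      have h2 := zEndOpt_pos hT
      simp only [List.append_nil, msValue] at *
      omega
    · exact zEndOpt_edit_le (s := []) (r := [b]) (by simp) (by simp) (by simpa using hv)

/-! ### Boundaries forced by first occurrences -/

/-- In `A ++ W` the string `W` occurs as a suffix only. -/
def FirstOcc (A W : List α) : Prop :=
  ∀ A₀ C₀ : List α, A₀ ++ (W ++ C₀) = A ++ W → C₀ = []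

/-- A phrase boundary lies strictly inside the first occurrence of a string of length at least
two. -/
theorem Fac.exists_boundary {m : ℕ} {T : List α} {B : Set (List α)} (h : Fac m T B)
    {A W C : List α} (hT : T = A ++ (W ++ C)) (hW : 2 ≤ W.length) (hnew : FirstOcc A W) :
    ∃ P ∈ B, A.length < P.length ∧ P.length < A.length + W.length := by
  have step : ∀ {n : ℕ} {T₀ f C : List α} {B : Set (List α)}, Fac n T₀ B →
      T₀ ++ f = A ++ (W ++ C) →
      (∀ C', T₀ = A ++ (W ++ C') → ∃ P ∈ B, A.length < P.length ∧ P.length < A.length + W.length) →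
      (f.length ≤ 1 ∨ ∃ P ∈ B, f <:+ P) →
      ∃ P ∈ insert (T₀ ++ f) B, A.length < P.length ∧ P.length < A.length + W.length := by
    intro n T₀ f C B h hT ih hf
    rw [← List.append_assoc] at hT
    rcases List.append_eq_append_iff.1 hT with ⟨D, h1, h2⟩ | ⟨C', h1, -⟩
    · rcases Nat.lt_or_ge A.length T₀.length with hlt | hge
      · rcases Nat.lt_or_ge T₀.length (A.length + W.length) with hlt' | hge'
        · exact ⟨T₀, Or.inr h.self_mem, hlt, hlt'⟩
        · have hD : D = [] := by
            have := congrArg List.length h1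
            simp only [List.length_append] at this
            exact List.length_eq_zero_iff.1 (by omega)
          obtain ⟨P, hP, hP'⟩ := ih [] (by simpa [hD] using h1.symm)
          exact ⟨P, Or.inr hP, hP'⟩
      · exfalso
        obtain ⟨A', rfl⟩ : ∃ A', A = T₀ ++ A' := by
          rcases List.append_eq_append_iff.1 h1 with ⟨x, hx, -⟩ | ⟨x, hx, -⟩
          · have := congrArg List.length hx
            simp only [List.length_append] at this
            obtain rfl : x = [] := List.length_eq_zero_iff.1 (by omega)
            exact ⟨[], by simpa using hx.symm⟩
          · exact ⟨x, hx⟩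
        obtain rfl : D = A' ++ W := by simpa [eq_comm] using h1
        rcases hf with hf | ⟨P, hP, P₀, hfP⟩
        · rw [h2] at hf
          simp only [List.length_append] at hf
          omega
        · obtain ⟨R, hR⟩ := h.isPrefix hP
          -- A phrase containing all of `W` is copied from an earlier prefix, which would give an
          -- earlier occurrence of `W`.
          have := hnew (P₀ ++ A') (C ++ (R ++ (A' ++ W))) (by
            rw [List.append_assoc T₀, ← hR, ← hfP, h2]
            simp)
          have := congrArg List.length this
          simp only [List.length_append, List.length_nil] at this
          omega
    · obtain ⟨P, hP, hP'⟩ := ih C' (by simpa using h1)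
      exact ⟨P, Or.inr hP, hP'⟩
  induction h generalizing C with
  | nil =>
    have := congrArg List.length hT
    simp only [List.length_append, List.length_nil] at this
    omega
  | fresh c h hc ih => exact step h hT (fun _ h => ih h) (Or.inl (by simp))
  | copy f P h hf hP hs ih =>
    exact step h hT (fun _ h => ih h) (Or.inr ⟨P, hP, hs⟩)

/-- At least `q` of the boundaries in `B` are at positions up to `p`. -/
def Cuts (B : Set (List α)) (q p : ℕ) : Prop :=
  ∃ S : Finset ℕ, S.card = q ∧ ∀ x ∈ S, x ≤ p ∧ ∃ P ∈ B, P.length = x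

theorem Cuts.mono {B : Set (List α)} {q p p' : ℕ} (h : Cuts B q p) (hp : p ≤ p') :
    Cuts B q p' := by
  obtain ⟨S, h1, h2⟩ := h
  exact ⟨S, h1, fun x hx => ⟨(h2 x hx).1.trans hp, (h2 x hx).2⟩⟩

/-- The new boundary is strictly to the right of `A`, hence not yet counted. It is also strictly
left of the end of `W`, so the next window may start at the last letter of `W`. -/
theorem Cuts.succ {m : ℕ} {T : List α} {B : Set (List α)} (h : Fac m T B) {A W C : List α}
    (hT : T = A ++ (W ++ C)) (hW : 2 ≤ W.length) (hnew : FirstOcc A W) {q : ℕ}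
    (hq : Cuts B q A.length) : Cuts B (q + 1) (A.length + W.length - 1) := by
  obtain ⟨P, hP, h1, h2⟩ := h.exists_boundary hT hW hnew
  obtain ⟨S, hS, hS'⟩ := hq
  refine ⟨insert P.length S, ?_, ?_⟩
  · rw [Finset.card_insert_of_notMem, hS]
    exact fun hmem => by have := (hS' _ hmem).1; omega
  · intro x hx
    rcases Finset.mem_insert.1 hx with rfl | hx
    · exact ⟨by omega, P, hP, rfl⟩
    · exact ⟨by have := (hS' _ hx).1; omega, (hS' _ hx).2⟩

theorem Fac.finite_ncard {m : ℕ} {T : List α} {B : Set (List α)} (h : Fac m T B) :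
    B.Finite ∧ B.ncard ≤ m + 1 := by
  induction h with
  | nil => simp
  | fresh c h hc ih => exact ⟨ih.1.insert _, (Set.ncard_insert_le _ _).trans (by omega)⟩
  | copy f P h hf hP hs ih => exact ⟨ih.1.insert _, (Set.ncard_insert_le _ _).trans (by omega)⟩

theorem Cuts.le {m : ℕ} {T : List α} {B : Set (List α)} (h : Fac m T B) {q p : ℕ}
    (hq : Cuts B q p) : q ≤ m + 1 := by
  obtain ⟨S, rfl, hS⟩ := hq
  have hsub : (S : Set ℕ) ⊆ List.length '' B := fun x hx => (hS x hx).2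
  rw [← Set.ncard_coe_finset]
  exact (Set.ncard_le_ncard hsub (h.finite_ncard.1.image _)).trans
    ((Set.ncard_image_le h.finite_ncard.1).trans h.finite_ncard.2)

/-! ### Ramps, blocks and their occurrences -/

/-- The string `xᵢ ⋯ x₂ x₁`, where the letters `x₁, x₂, …` have period three. -/
def ramp (e : ℕ ↪ α) : ℕ → List α
  | 0 => []
  | i + 1 => e ((i + 1) % 3) :: ramp e i

@[simp] theorem length_ramp (e : ℕ ↪ α) (i : ℕ) : (ramp e i).length = i := by
  induction i <;> simp_all [ramp]

theorem notMem_ramp (e : ℕ ↪ α) {c : ℕ} (hc : 3 ≤ c) (i : ℕ) : e c ∉ ramp e i := by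
  induction i with
  | zero => simp [ramp]
  | succ i ih =>
    simp only [ramp, List.mem_cons, EmbeddingLike.apply_eq_iff_eq, not_or]
    exact ⟨by omega, ih⟩

/-- The concatenation of the blocks `ramp e i ++ [e 3, e 4]`, where `i` runs through a list. -/
def blocks (e : ℕ ↪ α) : List ℕ → List α
  | [] => []
  | i :: w => ramp e i ++ e 3 :: e 4 :: blocks e w

@[simp] theorem blocks_append (e : ℕ ↪ α) (v w : List ℕ) :
    blocks e (v ++ w) = blocks e v ++ blocks e w := by
  induction v <;> simp_all [blocks]

/-- Ramps avoid `e 3`, so the first separator determines the first block; this makes the block code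
uniquely decodable. -/
theorem ramp_append_eq_blocks {e : ℕ ↪ α} {i : ℕ} {D : List α} {w : List ℕ}
    (h : ramp e i ++ e 3 :: D = blocks e w) : ∃ w', w = i :: w' ∧ D = e 4 :: blocks e w' := by
  cases w with
  | nil => simp [blocks] at h
  | cons t w =>
    have h3 := notMem_ramp e le_rfl
    rcases List.append_eq_append_iff.1 h with ⟨_ | ⟨y, x⟩, h1, h2⟩ | ⟨_ | ⟨y, x⟩, h1, h2⟩
    · obtain rfl : t = i := by simpa using congrArg List.length h1
      exact ⟨w, rfl, (List.cons.inj h2).2⟩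
    · have := h3 t
      simp_all
    · obtain rfl : i = t := by simpa using congrArg List.length h1
      exact ⟨w, rfl, (List.cons.inj h2).2.symm⟩
    · have := h3 i
      simp_all

theorem blocks_append_eq_blocks {e : ℕ ↪ α} {v w : List ℕ} {X : List α}
    (h : blocks e v ++ X = blocks e w) : ∃ w', w = v ++ w' ∧ X = blocks e w' := by
  induction v generalizing w with
  | nil => exact ⟨w, rfl, h⟩
  | cons i v ih =>
    simp only [blocks, List.append_assoc, List.cons_append] at h
    obtain ⟨w', rfl, h'⟩ := ramp_append_eq_blocks h
    obtain ⟨w'', rfl, h''⟩ := ih (List.cons.inj h').2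
    exact ⟨w'', rfl, h''⟩

/-- The occurrences of the separator `e 3` in a list of blocks with some prefix. -/
theorem append_eq_append_blocks {e : ℕ ↪ α} {A C pre : List α} {w : List ℕ}
    (h : A ++ e 3 :: C = pre ++ blocks e w) :
    (∃ E, pre = A ++ e 3 :: E ∧ C = E ++ blocks e w) ∨
      ∃ w₁ t w₂, w = w₁ ++ t :: w₂ ∧ A = pre ++ (blocks e w₁ ++ ramp e t) ∧
        C = e 4 :: blocks e w₂ := by
  induction w generalizing A pre with
  | nil => exact Or.inl ⟨C, by simpa [blocks] using h.symm, by simp [blocks]⟩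
  | cons t w ih =>
    have h3 := notMem_ramp e le_rfl t
    rcases List.append_eq_append_iff.1 h with ⟨_ | ⟨y, x⟩, h1, h2⟩ | ⟨x, rfl, h2⟩
    · right
      refine ⟨[], t, w, rfl, ?_⟩
      obtain ⟨w', h4, h5⟩ := ramp_append_eq_blocks (e := e) (i := 0) (D := C) (w := t :: w)
        (by simpa [ramp] using h2)
      obtain ⟨rfl, rfl⟩ := List.cons.inj h4
      exact ⟨by simpa [blocks, ramp] using h1.symm, h5⟩
    · obtain ⟨rfl, rfl⟩ := List.cons.inj h2
      exact Or.inl ⟨x, h1, rfl⟩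
    · right
      rcases List.append_eq_append_iff.1 h2 with ⟨_ | ⟨y, z⟩, rfl, h5⟩ | ⟨_ | ⟨y, z⟩, h4, h5⟩
      · simp only [List.nil_append, List.cons.injEq, true_and] at h5
        exact ⟨[], t, w, rfl, by simp [blocks], h5.symm⟩
      · simp only [List.cons_append, List.cons.injEq] at h5
        obtain ⟨rfl, h5⟩ := h5
        rcases z with _ | ⟨y, z⟩
        · simp at h5
        · simp only [List.cons_append, List.cons.injEq] at h5
          obtain ⟨rfl, h5⟩ := h5
          rcases ih (pre := []) h5.symm with ⟨E, hE, -⟩ | ⟨w₁, t', w₂, rfl, rfl, h6⟩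
          · simp at hE
          · exact ⟨t :: w₁, t', w₂, rfl, by simp [blocks], h6⟩
      · simp only [List.nil_append, List.cons.injEq, true_and, List.append_nil] at h5 h4
        exact ⟨[], t, w, rfl, by simp [blocks, h4], h5⟩
      · obtain ⟨rfl, -⟩ := List.cons.inj h5
        simp [h4] at h3

/-- The occurrences of a word in a word that starts with it and then has a letter not in it. -/
theorem append_eq_append_cons_of_notMem {Z w₁ w₂ R : List ℕ} {b : ℕ} (hb : b ∉ Z)
    (h : w₁ ++ (Z ++ w₂) = Z ++ b :: R) :
    (w₁ = [] ∧ w₂ = b :: R) ∨ ∃ w, w₁ = Z ++ b :: w ∧ w ++ (Z ++ w₂) = R := by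
  rcases List.append_eq_append_iff.1 h with ⟨x, h1, h2⟩ | ⟨_ | ⟨y, x⟩, h1, h2⟩
  · left
    rcases List.append_eq_append_iff.1 h2 with ⟨_ | ⟨y, z⟩, h3, h4⟩ | ⟨_ | ⟨y, z⟩, h3, h4⟩
    · have := congrArg List.length h1
      have := congrArg List.length h3
      simp only [List.length_append] at *
      exact ⟨List.length_eq_zero_iff.1 (by simp only [List.length_nil] at *; omega), by simpa using h4⟩
    · have := congrArg List.length h1
      have := congrArg List.length h3
      simp only [List.length_append, List.length_cons] at *
      omega
    · have := congrArg List.length h1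
      have := congrArg List.length h3
      simp only [List.length_append] at *
      exact ⟨List.length_eq_zero_iff.1 (by simp only [List.length_nil] at *; omega), by simpa using h4.symm⟩
    · obtain ⟨rfl, -⟩ := List.cons.inj h4
      simp [h3] at hb
  · cases Z with
    | nil => exact Or.inl ⟨by simpa using h1, by simpa using h2.symm⟩
    | cons z Z =>
      obtain ⟨rfl, -⟩ := List.cons.inj h2
      simp at hb
  · obtain ⟨rfl, h2⟩ := List.cons.inj h2
    exact Or.inr ⟨x, h1, by simpa using h2.symm⟩

theorem mem_of_append_eq_append_cons {A r Q s : List α} {d : α} (h : A ++ r = Q ++ d :: s)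
    (hlen : s.length < r.length) : d ∈ r := by
  rcases List.append_eq_append_iff.1 h with ⟨x, -, rfl⟩ | ⟨_ | ⟨y, x⟩, -, h2⟩
  · simp
  · rw [List.nil_append] at h2
    simp [← h2]
  · obtain ⟨rfl, rfl⟩ := List.cons.inj h2
    simp at hlen

/-- The prefixes in front of the blocks: they end with `e 4`, and if they contain `e 3`, then only
as a part of the suffix `[e 4, e 3, e 4]`. -/
structure IsHead (e : ℕ ↪ α) (pre : List α) : Prop where
  end_eq : ∃ Q, pre = Q ++ [e 4]
  sep : ∀ A E, pre = A ++ e 3 :: E → E = [e 4] ∧ ∃ Q, A = Q ++ [e 4]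

/-- Every earlier `e 3` is preceded by a ramp shorter than `j` with an `e 4` in front of it, or
directly by `e 4` in the head, while `ramp e j` contains no `e 4`. -/
theorem firstOcc_ramp {e : ℕ ↪ α} {pre : List α} (hpre : IsHead e pre) {w : List ℕ} {j : ℕ}
    (hj : 1 ≤ j) (hw : ∀ t ∈ w, t < j) : FirstOcc (pre ++ blocks e w) (ramp e j ++ [e 3]) := by
  intro A C h
  have h4 := notMem_ramp e (c := 4) (by omega) j
  -- The extra `e 4` completes the last block, so that occurrences can be decoded.
  have h' : (A ++ ramp e j) ++ e 3 :: (C ++ [e 4]) = pre ++ blocks e (w ++ [j]) := by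
    have := congrArg (· ++ [e 4]) h
    simpa [blocks] using this
  rcases append_eq_append_blocks h' with ⟨E, hE, -⟩ | ⟨w₁, t, w₂, hw', hA, hC⟩
  · obtain ⟨-, Q, hQ⟩ := hpre.sep _ _ hE
    exact absurd (mem_of_append_eq_append_cons hQ (by simp; omega)) h4
  · rcases List.eq_nil_or_concat w₂ with rfl | ⟨w₂, s, rfl⟩
    · simpa [blocks] using hC
    · have ht : t ∈ w := by
        have : w ++ [j] = (w₁ ++ t :: w₂) ++ [s] := by simpa using hw'
        rw [(List.append_inj' this rfl).1]
        simp
      obtain ⟨Q, hQ⟩ : ∃ Q, pre ++ blocks e w₁ = Q ++ [e 4] := by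
        obtain ⟨Q, rfl⟩ := hpre.end_eq
        rcases List.eq_nil_or_concat w₁ with rfl | ⟨w₁, s, rfl⟩
        · exact ⟨Q, by simp [blocks]⟩
        · exact ⟨Q ++ e 4 :: (blocks e w₁ ++ (ramp e s ++ [e 3])), by simp [blocks]⟩
      rw [← List.append_assoc, hQ, List.append_assoc] at hA
      exact absurd (mem_of_append_eq_append_cons hA (by simpa using hw t ht)) h4

/-- The word `Z b` also starts the block sequence, but there no `e 3` stands in front of it. This is
where a head without `e 3` is needed, and why insertion yields only two windows per level. -/
theorem firstOcc_blocks_ramp {e : ℕ ↪ α} {pre : List α} (hpre : e 3 ∉ pre) {Z : List ℕ} {b c : ℕ}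
    (hb : b ∉ Z) (hc : c ∉ Z) (hbc : b ≠ c) :
    FirstOcc (pre ++ (blocks e (Z ++ b :: Z) ++ ramp e c))
      (e 3 :: e 4 :: (blocks e Z ++ (ramp e b ++ [e 3]))) := by
  intro A C h
  have h' : A ++ e 3 :: (e 4 :: (blocks e Z ++ (ramp e b ++ e 3 :: (C ++ [e 4])))) =
      pre ++ blocks e (Z ++ b :: (Z ++ c :: (Z ++ [b]))) := by
    have := congrArg (· ++ [e 4]) h
    simpa [blocks] using this
  rcases append_eq_append_blocks h' with ⟨E, rfl, -⟩ | ⟨w₁, t, w₂, hw, -, hC⟩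
  · simp at hpre
  · obtain ⟨w₃, rfl, h3⟩ := blocks_append_eq_blocks (List.cons.inj hC).2
    obtain ⟨w₄, rfl, h4⟩ := ramp_append_eq_blocks h3
    have hw' : (w₁ ++ [t]) ++ (Z ++ b :: w₄) = Z ++ b :: (Z ++ c :: (Z ++ [b])) := by
      simpa using hw.symm
    suffices w₄ = [] by simpa [this, blocks] using h4
    rcases append_eq_append_cons_of_notMem hb hw' with ⟨h5, -⟩ | ⟨v, -, h5⟩
    · simp at h5
    rcases append_eq_append_cons_of_notMem hc h5 with ⟨-, h6⟩ | ⟨v, -, h6⟩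
    · exact absurd (List.cons.inj h6).1 hbc
    rcases append_eq_append_cons_of_notMem hb h6 with ⟨-, h7⟩ | ⟨v, -, h7⟩
    · exact (List.cons.inj h7).2
    · simp at h7

/-- The earlier copies of `Z` are followed by the blocks `b`, `c`, `b`, whose ramps start with
letters different from that of `ramp e (n + 1)`. Three consecutive lengths must therefore have
distinct first letters, which is what period three provides. -/
theorem firstOcc_blocks_letter {e : ℕ ↪ α} {pre : List α} (hpre : IsHead e pre) {Z : List ℕ}
    {b c n : ℕ} (hb : b ∉ Z) (hc : c ∉ Z) (hn : n + 1 ∉ Z) (hbn : b % 3 ≠ (n + 1) % 3)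
    (hcn : c % 3 ≠ (n + 1) % 3) :
    FirstOcc (pre ++ (blocks e (Z ++ b :: (Z ++ c :: Z)) ++ ramp e b))
      (e 3 :: e 4 :: (blocks e Z ++ [e ((n + 1) % 3)])) := by
  intro A C h
  have h' : A ++ e 3 :: (e 4 :: (blocks e Z ++
      e ((n + 1) % 3) :: (C ++ (ramp e n ++ [e 3, e 4])))) =
      pre ++ blocks e (Z ++ b :: (Z ++ c :: (Z ++ b :: (Z ++ [n + 1])))) := by
    have := congrArg (· ++ (ramp e n ++ [e 3, e 4])) h
    simpa [blocks, ramp] using this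
  obtain ⟨w₁, w₂, hw, hC⟩ : ∃ w₁ w₂,
      w₁ ++ w₂ = Z ++ b :: (Z ++ c :: (Z ++ b :: (Z ++ [n + 1]))) ∧
      blocks e Z ++ e ((n + 1) % 3) :: (C ++ (ramp e n ++ [e 3, e 4])) = blocks e w₂ := by
    rcases append_eq_append_blocks h' with ⟨E, hE, hE'⟩ | ⟨w₁, t, w₂, hw, -, hC⟩
    · obtain ⟨rfl, -⟩ := hpre.sep _ _ hE
      exact ⟨[], _, rfl, (List.cons.inj hE').2⟩
    · exact ⟨w₁ ++ [t], w₂, by simpa using hw.symm, (List.cons.inj hC).2⟩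
  obtain ⟨w₃, rfl, h3⟩ := blocks_append_eq_blocks hC
  obtain ⟨t, w₄, rfl, ht⟩ : ∃ t w₄, w₃ = t :: w₄ ∧ t % 3 = (n + 1) % 3 := by
    rcases w₃ with _ | ⟨_ | t, w₄⟩
    · simp [blocks] at h3
    · simp only [blocks, ramp, List.nil_append, List.cons.injEq, EmbeddingLike.apply_eq_iff_eq]
        at h3
      omega
    · simp only [blocks, ramp, List.cons_append, List.cons.injEq, EmbeddingLike.apply_eq_iff_eq]
        at h3
      exact ⟨_, _, rfl, h3.1.symm⟩
  rcases append_eq_append_cons_of_notMem hb hw with ⟨-, h4⟩ | ⟨v, -, h4⟩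
  · rw [(List.cons.inj h4).1] at ht
    exact absurd ht hbn
  rcases append_eq_append_cons_of_notMem hc h4 with ⟨-, h5⟩ | ⟨v, -, h5⟩
  · rw [(List.cons.inj h5).1] at ht
    exact absurd ht hcn
  rcases append_eq_append_cons_of_notMem hb h5 with ⟨-, h6⟩ | ⟨v, -, h6⟩
  · rw [(List.cons.inj h6).1] at ht
    exact absurd ht hbn
  rcases append_eq_append_cons_of_notMem hn h6 with ⟨-, h7⟩ | ⟨v, -, h7⟩
  · obtain ⟨rfl, rfl⟩ := List.cons.inj h7
    simpa [blocks, ramp] using h3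
  · simp at h7

/-! ### Zimin words and the lower bound after the edit -/

/-- The Zimin words. -/
def zimin : ℕ → List ℕ
  | 0 => []
  | j + 1 => zimin j ++ (j + 1) :: zimin j

theorem le_of_mem_zimin {j t : ℕ} (h : t ∈ zimin j) : t ≤ j := by
  induction j with
  | zero => simp [zimin] at h
  | succ j ih =>
    simp only [zimin, List.mem_append, List.mem_cons] at h
    rcases h with h | h | h
    · exact (ih h).trans (by omega)
    · omega
    · exact (ih h).trans (by omega)

theorem exists_zimin_eq {i k : ℕ} (h : i < k) : ∃ w, zimin k = zimin i ++ (i + 1) :: w := by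
  induction k, h using Nat.le_induction with
  | base => exact ⟨_, rfl⟩
  | succ k hk ih =>
    obtain ⟨w, hw⟩ := ih
    exact ⟨w ++ (k + 1) :: zimin k, by rw [zimin, hw]; simp⟩

/-- Each level contributes `s` consecutive windows. The last reaches one letter into the following
block, so the count stops before the final levels; the `+ 1` accounts for the empty prefix, which is
a boundary too. -/
theorem Fac.le_of_zimin {e : ℕ ↪ α} {pre pad : List α} (hpre : IsHead e pre) {s k m : ℕ}
    (hs : s = 2 ∨ s = 3 ∧ e 3 ∉ pre) {B : Set (List α)}
    (h : Fac m (pre ++ (blocks e (zimin k) ++ pad)) B) : s * (k - 2) ≤ m + 1 := by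
  have key : ∀ i, i + 2 ≤ k → Cuts B (s * i) (pre ++ blocks e (zimin (i + 1))).length := by
    intro i
    induction i with
    | zero => exact fun _ => ⟨∅, by simp⟩
    | succ i ih =>
      intro hi
      have hcut := ih (by omega)
      have hZ : ∀ t, i < t → t ∉ zimin i := fun t ht hmem => by
        have := le_of_mem_zimin hmem
        omega
      obtain ⟨w, hw⟩ := exists_zimin_eq (show i + 2 < k by omega)
      -- With `Z = zimin i`, this displays `zimin (i + 2) = Z (i+1) Z (i+2) Z (i+1) Z` and the first
      -- letter of the next block, of index `i + 3`.
      have hT : pre ++ (blocks e (zimin k) ++ pad) = pre ++ (blocks e (zimin (i + 1)) ++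
          (ramp e (i + 2) ++ e 3 :: e 4 :: (blocks e (zimin i) ++ (ramp e (i + 1) ++
            e 3 :: e 4 :: (blocks e (zimin i) ++ e ((i + 2 + 1) % 3) :: (ramp e (i + 2) ++
              e 3 :: e 4 :: (blocks e w ++ pad))))))) := by
        rw [hw]
        simp [zimin, blocks, ramp]
      have c1 := Cuts.succ h (A := pre ++ blocks e (zimin (i + 1))) (W := ramp e (i + 2) ++ [e 3])
        (by rw [hT]; simp; rfl) (by simp)
        (firstOcc_ramp hpre (by omega) fun t ht => by have := le_of_mem_zimin ht; omega) hcut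
      have hA₂ : (pre ++ (blocks e (zimin (i + 1)) ++ ramp e (i + 2))).length =
          (pre ++ blocks e (zimin (i + 1))).length + (ramp e (i + 2) ++ [e 3]).length - 1 := by
        simp; omega
      have hA₃ : (pre ++ (blocks e (zimin i ++ (i + 1) :: (zimin i ++ (i + 2) :: zimin i)) ++
          ramp e (i + 1))).length = (pre ++ (blocks e (zimin (i + 1)) ++ ramp e (i + 2))).length +
          (e 3 :: e 4 :: (blocks e (zimin i) ++ (ramp e (i + 1) ++ [e 3]))).length - 1 := by
        simp [zimin, blocks]; omega
      have hA₄ : (pre ++ blocks e (zimin (i + 2))).length = (pre ++ (blocks e (zimin i ++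
          (i + 1) :: (zimin i ++ (i + 2) :: zimin i)) ++ ramp e (i + 1))).length +
          (e 3 :: e 4 :: (blocks e (zimin i) ++ [e ((i + 2 + 1) % 3)])).length - 1 := by
        simp [zimin, blocks]; omega
      rw [← hA₂] at c1
      have last : ∀ q, Cuts B q (pre ++ (blocks e (zimin i ++ (i + 1) :: (zimin i ++
          (i + 2) :: zimin i)) ++ ramp e (i + 1))).length →
          Cuts B (q + 1) (pre ++ blocks e (zimin (i + 2))).length := by
        intro q hq
        rw [hA₄]
        exact Cuts.succ h (by rw [hT]; simp [zimin, blocks]; rfl) (by simp)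
          (firstOcc_blocks_letter hpre (hZ _ (by omega)) (hZ _ (by omega)) (hZ _ (by omega))
            (by omega) (by omega)) hq
      rcases hs with rfl | ⟨rfl, h3⟩
      · exact last _ (c1.mono (by rw [hA₃]; simp))
      · have c2 := Cuts.succ h (A := pre ++ (blocks e (zimin (i + 1)) ++ ramp e (i + 2)))
          (W := e 3 :: e 4 :: (blocks e (zimin i) ++ (ramp e (i + 1) ++ [e 3])))
          (by rw [hT]; simp; rfl) (by simp)
          (firstOcc_blocks_ramp h3 (hZ _ (by omega)) (hZ _ (by omega)) (by omega)) c1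
        rw [← hA₃] at c2
        exact last _ c2
  rcases Nat.lt_or_ge k 2 with hk | hk
  · simp [Nat.sub_eq_zero_of_le hk.le]
  · exact (key (k - 2) (by omega)).le h

/-! ### Short factorizations before the edit -/

theorem ramp_add (e : ℕ ↪ α) (i m : ℕ) : ramp e (i + 3 * m) = ramp e i ++ ramp e (3 * m) := by
  induction i with
  | zero => simp [ramp]
  | succ i ih =>
    rw [show i + 1 + 3 * m = (i + 3 * m) + 1 by ring, ramp, ih, ramp,
      show (i + 3 * m + 1) % 3 = (i + 1) % 3 by omega]
    rfl

theorem ramp_suffix (e : ℕ ↪ α) {i j : ℕ} (h : i ≤ j) : ramp e i <:+ ramp e j := by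
  induction j, h using Nat.le_induction with
  | base => exact List.suffix_rfl
  | succ j _ ih => exact ih.trans (List.suffix_cons _ _)

/-- Three letters, then `s` doublings: a ramp whose length is a multiple of three can be repeated by
one phrase. -/
theorem exists_fac_ramp (e : ℕ ↪ α) (s : ℕ) : ∃ B, Fac (3 + s) (ramp e (3 * 2 ^ s)) B := by
  induction s with
  | zero =>
    exact ⟨_, ((Fac.nil.append_singleton (e 0)).append_singleton (e 2)).append_singleton (e 1)⟩
  | succ s ih =>
    obtain ⟨B, hB⟩ := ih
    rw [show 3 * 2 ^ (s + 1) = 3 * 2 ^ s + 3 * 2 ^ s by ring, ramp_add]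
    refine ⟨_, hB.copy _ _ ?_ hB.self_mem List.suffix_rfl⟩
    rw [← List.length_pos_iff, length_ramp]
    positivity

/-- The long initial ramp ends with `ramp e (j + 1)`, so the text added at each level is a suffix of
the current string and costs one phrase. -/
theorem exists_fac_blocks (e : ℕ ↪ α) {s j : ℕ} (hj : j ≤ 3 * 2 ^ s) :
    ∃ B, Fac (5 + s + j) (ramp e (3 * 2 ^ s) ++ e 3 :: e 4 :: blocks e (zimin j)) B := by
  induction j with
  | zero =>
    obtain ⟨B, hB⟩ := exists_fac_ramp e s
    have := (hB.append_singleton (e 3)).append_singleton (e 4)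
    rw [show 3 + s + 1 + 1 = 5 + s + 0 by ring] at this
    exact ⟨_, by simpa [zimin, blocks] using this⟩
  | succ j ih =>
    obtain ⟨B, hB⟩ := ih (by omega)
    obtain ⟨R, hR⟩ := ramp_suffix e hj
    have := hB.copy (ramp e (j + 1) ++ e 3 :: e 4 :: blocks e (zimin j)) _ (by simp) hB.self_mem
      ⟨R, by rw [← List.append_assoc, hR]⟩
    exact ⟨_, by simpa [zimin, blocks, ← add_assoc] using this⟩

/-! ### Padding to arbitrary lengths and the edited pairs -/

theorem Fac.exists_append_double {n : ℕ} {T : List α} {B : Set (List α)} (h : Fac n T B) {N : ℕ}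
    (h1 : T.length ≤ N) (h2 : N ≤ 2 * T.length) :
    ∃ pad, (T ++ pad).length = N ∧ ∃ m ≤ n + 1, ∃ B', Fac m (T ++ pad) B' := by
  obtain ⟨m, hm, hm'⟩ :=
    h.append_suffix (f := T.drop (2 * T.length - N)) h.self_mem (List.drop_suffix _ _)
  refine ⟨T.drop (2 * T.length - N), ?_, m, hm, _, hm'⟩
  simp only [List.length_append, List.length_drop]
  omega

theorem Fac.exists_append_quadruple {n : ℕ} {T : List α} {B : Set (List α)} (h : Fac n T B) {N : ℕ}
    (h1 : T.length ≤ N) (h2 : N ≤ 4 * T.length) :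
    ∃ pad, (T ++ pad).length = N ∧ ∃ m ≤ n + 2, ∃ B', Fac m (T ++ pad) B' := by
  obtain ⟨pad, hlen, m, hm, B', hB'⟩ := h.exists_append_double (N := min N (2 * T.length))
    (by omega) (by omega)
  obtain ⟨pad', hlen', m', hm', B'', hB''⟩ := hB'.exists_append_double (N := N)
    (by omega) (by omega)
  exact ⟨pad ++ pad', by simpa using hlen', m', by omega, B'', by simpa using hB''⟩

/-- The length of the blocks given by the `k`-th Zimin word. -/
def blockLength : ℕ → ℕ
  | 0 => 0
  | k + 1 => 2 * blockLength k + (k + 3)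

theorem length_blocks_zimin (e : ℕ ↪ α) (k : ℕ) :
    (blocks e (zimin k)).length = blockLength k := by
  induction k with
  | zero => rfl
  | succ k ih => simp [zimin, blocks, blockLength, ih]; ring

/-- The length of the unpadded string with parameter `k`. -/
def baseLength (k : ℕ) : ℕ := 3 * 2 ^ Nat.log 2 k + 2 + blockLength k

theorem le_ramp_length {k : ℕ} : k ≤ 3 * 2 ^ Nat.log 2 k := by
  have := Nat.lt_pow_succ_log_self one_lt_two k
  rw [pow_succ] at this
  omega

theorem le_baseLength (k : ℕ) : k ≤ baseLength k := by
  have := @le_ramp_length k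
  unfold baseLength
  omega

/-- The factor four matches the two padding phrases, so consecutive parameters leave no length
uncovered. -/
theorem baseLength_succ_le {k : ℕ} (hk : 1 ≤ k) : baseLength (k + 1) ≤ 4 * baseLength k := by
  have h1 : Nat.log 2 (k + 1) ≤ Nat.log 2 k + 1 := by
    rw [← Nat.log_mul_base one_lt_two (by omega)]
    exact Nat.log_mono_right (by omega)
  have h2 := Nat.pow_le_pow_right two_pos h1
  have h3 := @le_ramp_length k
  rw [pow_succ] at h2
  simp only [baseLength, blockLength]
  omega

theorem isHead_of_notMem {e : ℕ ↪ α} {Q : List α} (h : e 3 ∉ Q) : IsHead e (Q ++ [e 4]) := by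
  refine ⟨⟨Q, rfl⟩, fun A E hA => ?_⟩
  have : e 3 ∈ Q ++ [e 4] := by simp [hA]
  simp [h] at this

theorem isHead_insert {e : ℕ ↪ α} {Q : List α} (h : e 3 ∉ Q) :
    IsHead e (Q ++ [e 4, e 3, e 4]) := by
  refine ⟨⟨Q ++ [e 4, e 3], by simp⟩, fun A E hA => ?_⟩
  have hA' : (Q ++ [e 4]) ++ e 3 :: [e 4] = A ++ e 3 :: E := by simpa using hA
  rw [List.append_cons_inj_of_notMem (by simp [h]) (by simp)] at hA'
  exact ⟨hA'.2.2.symm, Q, hA'.1.symm⟩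

/-- All three edits act at the first `e 3`: it is replaced by `e 4`, deleted, or separated from the
ramp by an inserted `e 4`. The bound `k + log k + 7` consists of the ramp and separator, the `k`
levels and two padding phrases. -/
theorem exists_isEdit [Infinite α] (ed : Edit) {k N : ℕ} (h1 : baseLength k ≤ N)
    (h2 : N ≤ 4 * baseLength k) : ∃ T T' : List α, T.length = N ∧ IsEdit ed T T' ∧
      zEndOpt T ≤ k + Nat.log 2 k + 7 ∧ msValue ed * (k - 2) ≤ zEndOpt T' + 1 := by
  let e := Infinite.natEmbedding α
  obtain ⟨B, hB⟩ := exists_fac_blocks e (le_ramp_length (k := k))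
  have hlen : (ramp e (3 * 2 ^ Nat.log 2 k) ++ e 3 :: e 4 :: blocks e (zimin k)).length =
      baseLength k := by
    simp [length_blocks_zimin, baseLength]; ring
  obtain ⟨pad, hN, m, hm, B', hB'⟩ := hB.exists_append_quadruple (hlen.symm ▸ h1) (hlen.symm ▸ h2)
  have h3 := notMem_ramp e le_rfl (3 * 2 ^ Nat.log 2 k)
  have lower : ∀ {pre : List α} {s : ℕ}, IsHead e pre → (s = 2 ∨ s = 3 ∧ e 3 ∉ pre) →
      s * (k - 2) ≤ zEndOpt (pre ++ (blocks e (zimin k) ++ pad)) + 1 := by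
    intro pre s hpre hs
    obtain ⟨C, hC⟩ := exists_fac_zEndOpt (pre ++ (blocks e (zimin k) ++ pad))
    exact hC.le_of_zimin hpre hs
  have upper := hB'.zEndOpt_le
  cases ed with
  | sub =>
    refine ⟨_, (ramp e (3 * 2 ^ Nat.log 2 k) ++ [e 4, e 4]) ++ (blocks e (zimin k) ++ pad), hN,
      ⟨ramp e (3 * 2 ^ Nat.log 2 k), e 4 :: (blocks e (zimin k) ++ pad), e 3, e 4, by simp,
        by simp, by simp⟩, by omega, lower ?_ (Or.inr ⟨rfl, by simp [h3]⟩)⟩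
    simpa using isHead_of_notMem (Q := ramp e (3 * 2 ^ Nat.log 2 k) ++ [e 4]) (by simp [h3])
  | ins =>
    exact ⟨_, (ramp e (3 * 2 ^ Nat.log 2 k) ++ [e 4, e 3, e 4]) ++ (blocks e (zimin k) ++ pad), hN,
      ⟨ramp e (3 * 2 ^ Nat.log 2 k), e 3 :: e 4 :: (blocks e (zimin k) ++ pad), e 4,
        by simp, by simp⟩, by omega, lower (isHead_insert h3) (Or.inl rfl)⟩
  | del =>
    exact ⟨_, (ramp e (3 * 2 ^ Nat.log 2 k) ++ [e 4]) ++ (blocks e (zimin k) ++ pad), hN,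
      ⟨ramp e (3 * 2 ^ Nat.log 2 k), e 4 :: (blocks e (zimin k) ++ pad), e 3,
        by simp, by simp⟩, by omega,
      lower (isHead_of_notMem h3) (Or.inr ⟨rfl, by simp [h3]⟩)⟩

/-! ### Existence of the maximum and its limit -/

theorem ratios_nonempty [Infinite α] (e : Edit) {n : ℕ} (hn : 1 ≤ n) :
    (ratios e (zEndOpt (α := α)) n).Nonempty := by
  obtain ⟨a, b, hab⟩ := exists_pair_ne α
  obtain ⟨n, rfl⟩ : ∃ m, n = m + 1 := ⟨n - 1, by omega⟩
  cases e with
  | sub => exact ⟨_, a :: List.replicate n a, b :: List.replicate n a, by simp,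
      ⟨[], List.replicate n a, a, b, hab, rfl, rfl⟩, rfl⟩
  | ins => exact ⟨_, a :: List.replicate n a, b :: a :: List.replicate n a, by simp,
      ⟨[], _, b, rfl, rfl⟩, rfl⟩
  | del => exact ⟨_, a :: List.replicate n a, List.replicate n a, by simp,
      ⟨[], _, a, rfl, rfl⟩, rfl⟩

theorem IsEdit.length_le {e : Edit} {T T' : List α} (h : IsEdit e T T') :
    T'.length ≤ T.length + 1 := by
  cases e with
  | sub => obtain ⟨u, v, a, b, -, rfl, rfl⟩ := h; simp
  | ins => obtain ⟨u, v, b, rfl, rfl⟩ := h; simp; omega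
  | del => obtain ⟨u, v, a, rfl, rfl⟩ := h; simp; omega

/-- Over an infinite alphabet there are infinitely many strings, but numerators and denominators are
at most `n + 1`. -/
theorem ratios_finite (e : Edit) (n : ℕ) : (ratios e (zEndOpt (α := α)) n).Finite := by
  refine ((Set.finite_Iic (n + 1)).image2 (fun p q : ℕ => (p : ℝ) / (q : ℝ))
    (Set.finite_Iic (n + 1))).subset ?_
  rintro r ⟨T, T', hT, hTT', rfl⟩
  exact ⟨_, (zEndOpt_le_length T').trans (hT ▸ hTT'.length_le), _,
    (zEndOpt_le_length T).trans (by omega), rfl⟩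

theorem isGreatest_MS [Infinite α] (e : Edit) {n : ℕ} (hn : 1 ≤ n) :
    IsGreatest (ratios e (zEndOpt (α := α)) n) (MS e (zEndOpt (α := α)) n) :=
  ⟨(ratios_nonempty e hn).csSup_mem (ratios_finite e n),
    fun _ hr => le_csSup (ratios_finite e n).bddAbove hr⟩

theorem MS_le [Infinite α] (e : Edit) {n : ℕ} (hn : 1 ≤ n) :
    MS e (zEndOpt (α := α)) n ≤ (msValue e : ℝ) := by
  obtain ⟨T, T', hT, hTT', hr⟩ := (isGreatest_MS (α := α) e hn).1
  have hne : T ≠ [] := by rintro rfl; simp at hT; omega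
  rw [hr, div_le_iff₀ (by exact_mod_cast zEndOpt_pos hne)]
  exact_mod_cast zEndOpt_le_of_isEdit hne hTT'

/-- The largest parameter whose unpadded string has length at most `n`. -/
def parameter (n : ℕ) : ℕ := Nat.findGreatest (fun k => baseLength k ≤ n) n

theorem le_parameter {k n : ℕ} (h : baseLength k ≤ n) : k ≤ parameter n :=
  Nat.le_findGreatest ((le_baseLength k).trans h) h

theorem tendsto_parameter : Filter.Tendsto parameter Filter.atTop Filter.atTop :=
  Filter.tendsto_atTop.2 fun k => (Filter.eventually_ge_atTop (baseLength k)).mono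
    fun _ h => le_parameter h

theorem le_MS [Infinite α] (e : Edit) {n : ℕ} (hn : baseLength 3 ≤ n) :
    ((msValue e : ℝ) * ((parameter n : ℝ) - 2) - 1) / (parameter n + Nat.log 2 (parameter n) + 7) ≤
      MS e (zEndOpt (α := α)) n := by
  have hk := le_parameter hn
  have h1 : baseLength (parameter n) ≤ n :=
    Nat.findGreatest_spec (P := fun k => baseLength k ≤ n) ((le_baseLength 3).trans hn) hn
  -- Maximality of the parameter gives `n < baseLength (parameter n + 1)`.
  have h2 : n ≤ 4 * baseLength (parameter n) := by
    refine le_trans ?_ (baseLength_succ_le (by omega))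
    by_contra! h
    have := le_parameter h.le
    omega
  obtain ⟨T, T', hT, hTT', h3, h4⟩ := exists_isEdit (α := α) e h1 h2
  have hn1 : 3 ≤ n := (le_baseLength 3).trans hn
  refine le_trans ?_ ((isGreatest_MS (α := α) e (by omega)).2 ⟨T, T', hT, hTT', rfl⟩)
  have hne : T ≠ [] := by rintro rfl; simp at hT; omega
  have h5 : (msValue e : ℝ) * ((parameter n : ℝ) - 2) - 1 ≤ zEndOpt T' := by
    have : ((msValue e * (parameter n - 2) : ℕ) : ℝ) ≤ ((zEndOpt T' + 1 : ℕ) : ℝ) := by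
      exact_mod_cast h4
    push_cast [Nat.cast_sub (show 2 ≤ parameter n by omega)] at this
    linarith
  exact div_le_div₀ (by positivity) h5 (by exact_mod_cast zEndOpt_pos hne) (by exact_mod_cast h3)

theorem tendsto_natLog_div : Filter.Tendsto (fun k : ℕ => (Nat.log 2 k : ℝ) / k) Filter.atTop
    (nhds 0) := by
  have h := (Real.isLittleO_log_id_atTop.tendsto_div_nhds_zero.comp
    (tendsto_natCast_atTop_atTop (R := ℝ))).div_const (Real.log 2)
  rw [zero_div] at h
  refine squeeze_zero (fun k => by positivity) (fun k => ?_) h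
  have := Real.natLog_le_logb k 2
  simp only [Function.comp, id, Real.logb] at *
  rw [div_right_comm]
  exact div_le_div_of_nonneg_right (by exact_mod_cast this) (by positivity)

theorem tendsto_lower_bound (s : ℝ) :
    Filter.Tendsto (fun k : ℕ => (s * ((k : ℝ) - 2) - 1) / (k + Nat.log 2 k + 7)) Filter.atTop
      (nhds s) := by
  have h1 := tendsto_const_div_atTop_nhds_zero_nat (2 * s + 1)
  have h2 := tendsto_const_div_atTop_nhds_zero_nat (7 : ℝ)
  have h := (h1.const_sub s).div ((tendsto_natLog_div.const_add 1).add h2) (by norm_num)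
  simp only [sub_zero, add_zero, div_one] at h
  refine h.congr' ((Filter.eventually_gt_atTop 0).mono fun k hk => ?_)
  have hk' : (0 : ℝ) < k := by exact_mod_cast hk
  simp only [Pi.div_apply]
  rw [div_eq_div_iff (by positivity) (by positivity)]
  field_simp
  ring

end LZEnd

theorem mainTheorem6 (α : Type*) :
    (∀ (e : LZEnd.Edit) (T T' : List α), T ≠ [] → LZEnd.IsEdit e T T' →
      LZEnd.zEndOpt T' ≤ LZEnd.msValue e * LZEnd.zEndOpt T) ∧
    (Infinite α → ∀ e : LZEnd.Edit,
      (∀ n : ℕ, 1 ≤ n →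
        IsGreatest (LZEnd.ratios e (LZEnd.zEndOpt (α := α)) n)
          (LZEnd.MS e (LZEnd.zEndOpt (α := α)) n) ∧
        LZEnd.MS e (LZEnd.zEndOpt (α := α)) n ≤ (LZEnd.msValue e : ℝ)) ∧
      Filter.Tendsto (fun n : ℕ => LZEnd.MS e (LZEnd.zEndOpt (α := α)) n) Filter.atTop
        (nhds (LZEnd.msValue e : ℝ))) := by
  refine ⟨fun e T T' hT h => LZEnd.zEndOpt_le_of_isEdit hT h, fun _ e =>
    ⟨fun n hn => ⟨LZEnd.isGreatest_MS e hn, LZEnd.MS_le e hn⟩, ?_⟩⟩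
  exact tendsto_of_tendsto_of_tendsto_of_le_of_le'
    ((LZEnd.tendsto_lower_bound _).comp LZEnd.tendsto_parameter) tendsto_const_nhds
    ((Filter.eventually_ge_atTop _).mono fun n hn => LZEnd.le_MS e hn)
    ((Filter.eventually_ge_atTop 1).mono fun n hn => LZEnd.MS_le e hn)
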